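/- Let $H$ be a complex Hilbert space and let $\mathcal B(H)$ be the algebra of bounded linear operators on $H$, with the Löwner order ($X\le Y$ iff $Y-X$ is positive, i.e. $\langle (Y-X)x,x\rangle\ge 0$ for all $x\in H$). Real powers of positive invertible operators are defined by the continuous functional calculus. For positive invertible $A,B\in\mathcal B(H)$ and $k,t\in(0,1)$ let $$A\#_k B=A^{1/2}\bigl(A^{-1/2}BA^{-1/2}\bigr)^{k}A^{1/2},\qquad F_{k,t}(A,B)=(A^{-1}\#_k B)^{t}\,A^{1+2t-4kt}\,(A^{-1}\#_k B)^{t}.$$ **Theorem.** Let $k,t\in(0,\tfrac12]$ and put $L=1+2t-4kt$. Then $$\left(\frac1{2kt}-\frac{1-k}{Lk}\right)^{-1}=\frac{2ktL}{1-2kt}\le 1,$$ and for all positive invertible $A,B\in\mathcal B(H)$ the implication $$F_{k,t}(A,B)\le I\ \Longrightarrow\ F_{k,t}(A^q,B^q)\le I$$ holds for every real $q$ with $0<q\le \dfrac{2ktL}{1-2kt}$. -/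

import Mathlib

noncomputable section

namespace SpectralGeomMean

variable {H : Type*} [NormedAddCommGroup H] [InnerProductSpace ℂ H] [CompleteSpace H]

/-- The weighted geometric mean `A #ₜ B = A^{1/2} (A^{-1/2} B A^{-1/2})^t A^{1/2}` of a positive
invertible operator `A` and a positive operator `B`. Real powers are those of the continuous
functional calculus. -/
def geomMean (t : ℝ) (A B : H →L[ℂ] H) : H →L[ℂ] H :=
  A ^ (1 / 2 : ℝ) * (A ^ (-(1 / 2) : ℝ) * B * A ^ (-(1 / 2) : ℝ)) ^ t * A ^ (1 / 2 : ℝ)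

/-- The `(k, t)`-spectral geometric mean
`F_{k,t}(A, B) = (A⁻¹ #ₖ B)^t A^{1 + 2t - 4kt} (A⁻¹ #ₖ B)^t`. -/
def spectralGeomMean (k t : ℝ) (A B : H →L[ℂ] H) : H →L[ℂ] H :=
  geomMean k (Ring.inverse A) B ^ t * A ^ (1 + 2 * t - 4 * k * t) *
    geomMean k (Ring.inverse A) B ^ t

end SpectralGeomMean

end

namespace SpectralGeomMean

section CStar

variable {𝒜 : Type*} [CStarAlgebra 𝒜] [PartialOrder 𝒜] [StarOrderedRing 𝒜]

/-! Put `G = A⁻¹ #ₖ B`. The hypothesis says `G^(2t) ≤ A^(-L)`, and extending the mean to weights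
above 1 recovers `B = A⁻¹ #_{1/k} G`. A grand Furuta inequality (`cstarMean_rpow_le`) then turns the
hypothesis into `B^(q₀) ≤ A^(-L)`, where `q₀` is the largest admissible `q`. Löwner–Heinz lowers
`q₀` to `q`; monotonicity of the mean and of the power `2t` then returns the hypothesis for `A^q`,
`B^q`. -/

lemma rpow_mul_rpow {a : 𝒜} (ha : IsStrictlyPositive a) (x y : ℝ) :
    a ^ x * a ^ y = a ^ (x + y) :=
  (CFC.rpow_add ha.isUnit).symm

lemma rpow_rpow_of_isStrictlyPositive {a : 𝒜} (ha : IsStrictlyPositive a) (x y : ℝ) :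
    (a ^ x) ^ y = a ^ (x * y) := by
  rcases eq_or_ne x 0 with rfl | hx
  · rw [CFC.rpow_zero a ha.nonneg, CFC.one_rpow, zero_mul, CFC.rpow_zero a ha.nonneg]
  · exact CFC.rpow_rpow a x y hx ha

lemma rpow_neg_le_rpow_neg {a b : 𝒜} (ha : IsStrictlyPositive a) (hab : a ≤ b) {p : ℝ}
    (hp : p ∈ Set.Icc (0 : ℝ) 1) : b ^ (-p) ≤ a ^ (-p) := by
  have hb : IsStrictlyPositive b := ha.of_le hab
  have h := CStarAlgebra.rpow_neg_one_le_rpow_neg_one (CFC.rpow_le_rpow hp hab) (ha.rpow a p)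
  rwa [rpow_rpow_of_isStrictlyPositive ha, rpow_rpow_of_isStrictlyPositive hb, mul_neg_one] at h

lemma rpow_neg_half_mul_self_mul {a : 𝒜} (ha : IsStrictlyPositive a) (x : 𝒜) :
    a ^ (-(1 / 2) : ℝ) * (a ^ (1 / 2 : ℝ) * x * a ^ (1 / 2 : ℝ)) * a ^ (-(1 / 2) : ℝ) = x := by
  have h₁ := CFC.rpow_mul_rpow_neg (1 / 2) ha
  have h₂ := CFC.rpow_neg_mul_rpow (1 / 2) ha
  rw [mul_assoc, mul_assoc, mul_assoc, h₁, mul_one, ← mul_assoc, h₂, one_mul]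

/-- Powers of `X⋆X` and of `XX⋆` are intertwined by `X`. -/
lemma star_mul_self_rpow {X : 𝒜} (hX : IsUnit X) (s : ℝ) :
    (star X * X) ^ s = star X * (X * star X) ^ (s - 1) * X := by
  have hS : IsStrictlyPositive (star X * X) :=
    (hX.star.mul hX).isStrictlyPositive (star_mul_self_nonneg X)
  set S := star X * X with hSdef
  -- `U` is the unitary polar factor of `X`; it conjugates `S` to `X * star X`.
  set U := X * S ^ (-(1 / 2) : ℝ) with hU
  have hXU : U * S ^ (1 / 2 : ℝ) = X := by
    rw [hU, mul_assoc, CFC.rpow_neg_mul_rpow _ hS, mul_one]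
  have hstar (x : ℝ) : star (S ^ x) = S ^ x := CFC.rpow_nonneg.star_eq
  have hXU' : S ^ (1 / 2 : ℝ) * star U = star X := by
    conv_rhs => rw [← hXU, star_mul, hstar]
  have hUU : star U * U = 1 := by
    rw [hU, star_mul, hstar, mul_assoc, ← mul_assoc (star X), ← hSdef]
    nth_rw 2 [← CFC.rpow_one S hS.nonneg]
    rw [rpow_mul_rpow hS, rpow_mul_rpow hS]
    norm_num
    exact CFC.rpow_zero S hS.nonneg
  have hUunit : IsUnit U := hX.mul (hS.rpow S _).isUnit
  have hUU' : U * star U = 1 := by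
    obtain ⟨u, hu⟩ := hUunit
    have : star U = ↑u⁻¹ := by
      rw [← hu] at hUU ⊢
      exact u.eq_inv_of_mul_eq_one_right hUU
    rw [this, ← hu, u.mul_inv]
  let V : unitary 𝒜 := ⟨U, Unitary.mem_iff.mpr ⟨hUU, hUU'⟩⟩
  have hconj : X * star X = U * S * star U := by
    rw [← hXU', ← hXU]
    simp only [mul_assoc]
    rw [← mul_assoc (S ^ (1 / 2 : ℝ)), rpow_mul_rpow hS]
    norm_num
    rw [CFC.rpow_one S hS.nonneg]
  have hpow : (X * star X) ^ (s - 1) = U * S ^ (s - 1) * star U := by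
    have hcont : ContinuousOn (fun x : NNReal => x ^ (s - 1)) (spectrum NNReal S) :=
      NNReal.continuousOn_rpow_const (Or.inl (spectrum.zero_notMem _ hS.isUnit))
    have hnn : 0 ≤ U * S * star U := star_right_conjugate_nonneg hS.nonneg U
    have hφ : Continuous (Unitary.conjStarAlgAut ℂ 𝒜 V) :=
      (continuous_const.mul continuous_id).mul continuous_const
    have h := StarAlgHomClass.map_cfc (R := NNReal) (S := ℂ) (Unitary.conjStarAlgAut ℂ 𝒜 V)
      (fun x : NNReal => x ^ (s - 1)) S hcont hφ hS.nonneg hnn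
    rw [hconj]
    exact h.symm
  rw [hpow, ← hXU', ← hXU]
  have h₂ : star U * (U * S ^ (1 / 2 : ℝ)) = S ^ (1 / 2 : ℝ) := by
    rw [← mul_assoc, hUU, one_mul]
  simp only [mul_assoc, h₂]
  rw [← mul_assoc (star U), hUU, one_mul, rpow_mul_rpow hS, rpow_mul_rpow hS]
  congr 1
  ring

/-- The weighted geometric mean of elements of a C⋆-algebra. -/
noncomputable def cstarMean (s : ℝ) (P R : 𝒜) : 𝒜 :=
  P ^ (1 / 2 : ℝ) * (P ^ (-(1 / 2) : ℝ) * R * P ^ (-(1 / 2) : ℝ)) ^ s * P ^ (1 / 2 : ℝ)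

lemma isStrictlyPositive_rpow_conj {P R : 𝒜} (hP : IsStrictlyPositive P)
    (hR : IsStrictlyPositive R) (x : ℝ) : IsStrictlyPositive (P ^ x * R * P ^ x) :=
  IsStrictlyPositive.conjugate_of_isUnit_of_isSelfAdjoint R (P ^ x) (hP.rpow P x).isUnit
    (hP.rpow P x).isSelfAdjoint hR

lemma isStrictlyPositive_cstarMean {P R : 𝒜} (hP : IsStrictlyPositive P)
    (hR : IsStrictlyPositive R) (s : ℝ) : IsStrictlyPositive (cstarMean s P R) :=
  isStrictlyPositive_rpow_conj hP ((isStrictlyPositive_rpow_conj hP hR _).rpow _ s) _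

lemma cstarMean_one {P R : 𝒜} (hP : IsStrictlyPositive P) (hR : IsStrictlyPositive R) :
    cstarMean 1 P R = R := by
  rw [cstarMean, CFC.rpow_one _ (isStrictlyPositive_rpow_conj hP hR _).nonneg]
  have h₁ := CFC.rpow_mul_rpow_neg (1 / 2) hP
  have h₂ := CFC.rpow_neg_mul_rpow (1 / 2) hP
  rw [mul_assoc, mul_assoc, mul_assoc, h₂, mul_one, ← mul_assoc, h₁, one_mul]

lemma cstarMean_cstarMean {P R : 𝒜} (hP : IsStrictlyPositive P) (hR : IsStrictlyPositive R)
    (s r : ℝ) : cstarMean r P (cstarMean s P R) = cstarMean (s * r) P R := by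
  rw [cstarMean, cstarMean, rpow_neg_half_mul_self_mul hP,
    rpow_rpow_of_isStrictlyPositive (isStrictlyPositive_rpow_conj hP hR _), cstarMean]

lemma cstarMean_le_cstarMean {P R T : 𝒜} (hRT : R ≤ T) {s : ℝ} (hs : s ∈ Set.Icc (0 : ℝ) 1) :
    cstarMean s P R ≤ cstarMean s P T :=
  conjugate_le_conjugate_of_nonneg
    (CFC.rpow_le_rpow hs (conjugate_le_conjugate_of_nonneg hRT CFC.rpow_nonneg)) CFC.rpow_nonneg

lemma cstarMean_rpow_rpow {P : 𝒜} (hP : IsStrictlyPositive P) (x y s : ℝ) :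
    cstarMean s (P ^ x) (P ^ y) = P ^ ((1 - s) * x + s * y) := by
  simp only [cstarMean, rpow_rpow_of_isStrictlyPositive hP, rpow_mul_rpow hP]
  congr 1
  ring

/-- Moves the inner exponent from `s` to `s - 1`, so that operator monotonicity applies for `s` in
`[1, 2]`. -/
lemma cstarMean_eq_conj {P R : 𝒜} (hP : IsStrictlyPositive P) (hR : IsStrictlyPositive R)
    (s : ℝ) : cstarMean s P R =
      R ^ (1 / 2 : ℝ) * (R ^ (1 / 2 : ℝ) * P ^ (-1 : ℝ) * R ^ (1 / 2 : ℝ)) ^ (s - 1) *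
        R ^ (1 / 2 : ℝ) := by
  set X : 𝒜 := R ^ (1 / 2 : ℝ) * P ^ (-(1 / 2) : ℝ) with hX
  have hXu : IsUnit X := (hR.rpow R _).isUnit.mul (hP.rpow P _).isUnit
  have hsX : star X = P ^ (-(1 / 2) : ℝ) * R ^ (1 / 2 : ℝ) := by
    rw [hX, star_mul, CFC.rpow_nonneg.star_eq, CFC.rpow_nonneg.star_eq]
  have hhalf : R ^ (1 / 2 : ℝ) * R ^ (1 / 2 : ℝ) = R := by
    rw [rpow_mul_rpow hR]
    norm_num
    exact CFC.rpow_one R hR.nonneg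
  have h₁ : P ^ (-(1 / 2) : ℝ) * R * P ^ (-(1 / 2) : ℝ) = star X * X := by
    rw [hsX, hX]
    conv_lhs => rw [← hhalf]
    simp only [mul_assoc]
  have h₂ : R ^ (1 / 2 : ℝ) * P ^ (-1 : ℝ) * R ^ (1 / 2 : ℝ) = X * star X := by
    have : P ^ (-1 : ℝ) = P ^ (-(1 / 2) : ℝ) * P ^ (-(1 / 2) : ℝ) := by
      rw [rpow_mul_rpow hP]
      norm_num
    rw [hsX, hX, this]
    simp only [mul_assoc]
  have h₃ : P ^ (1 / 2 : ℝ) * star X = R ^ (1 / 2 : ℝ) := by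
    rw [hsX, ← mul_assoc, CFC.rpow_mul_rpow_neg _ hP, one_mul]
  have h₄ : X * P ^ (1 / 2 : ℝ) = R ^ (1 / 2 : ℝ) := by
    rw [hX, mul_assoc, CFC.rpow_neg_mul_rpow _ hP, mul_one]
  rw [cstarMean, h₁, h₂, star_mul_self_rpow hXu]
  generalize (X * star X) ^ (s - 1) = Z
  rw [mul_assoc, mul_assoc, h₄, ← mul_assoc, ← mul_assoc, h₃]

lemma cstarMean_rpow_le_of_le_two {P Q : 𝒜} (hQ : IsStrictlyPositive Q) (hQP : Q ≤ P)
    {τ p s : ℝ} (hτ : τ ∈ Set.Icc (0 : ℝ) 1) (hp : 1 ≤ p) (hs : s ∈ Set.Icc (1 : ℝ) 2) :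
    cstarMean s (P ^ τ) (Q ^ p) ^ ((p - τ) * s + τ)⁻¹ ≤ P := by
  have hP : IsStrictlyPositive P := hQ.of_le hQP
  have hd : 1 ≤ (p - τ) * s + τ := by nlinarith [hτ.1, hτ.2, hs.1]
  have hle : cstarMean s (P ^ τ) (Q ^ p) ≤ Q ^ ((p - τ) * s + τ) := by
    rw [cstarMean_eq_conj (hP.rpow P τ) (hQ.rpow Q p), rpow_rpow_of_isStrictlyPositive hP,
      mul_neg_one]
    have h₁ : ((Q ^ p) ^ (1 / 2 : ℝ) * P ^ (-τ) * (Q ^ p) ^ (1 / 2 : ℝ)) ≤ Q ^ (p - τ) := by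
      refine (conjugate_le_conjugate_of_nonneg (rpow_neg_le_rpow_neg hQ hQP hτ)
        CFC.rpow_nonneg).trans_eq ?_
      rw [rpow_rpow_of_isStrictlyPositive hQ, rpow_mul_rpow hQ, rpow_mul_rpow hQ]
      congr 1
      ring
    refine (conjugate_le_conjugate_of_nonneg
      (CFC.rpow_le_rpow (p := s - 1) ⟨by linarith [hs.1], by linarith [hs.2]⟩ h₁)
      CFC.rpow_nonneg).trans_eq ?_
    simp only [rpow_rpow_of_isStrictlyPositive hQ, rpow_mul_rpow hQ]
    congr 1
    ring
  refine (CFC.rpow_le_rpow ⟨by positivity, inv_le_one_of_one_le₀ hd⟩ hle).trans ?_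
  rwa [rpow_rpow_of_isStrictlyPositive hQ, mul_inv_cancel₀ (by positivity),
    CFC.rpow_one Q hQ.nonneg]

/-- Doubling: the case `s = 2` gives a new `Q` below `P`, to which the weight `s / 2` is applied.
With `p' = (p - τ) * 2 + τ`, the outer exponent is unchanged. -/
lemma cstarMean_rpow_le_of_le_two_pow {P : 𝒜} {τ : ℝ} (hτ : τ ∈ Set.Icc (0 : ℝ) 1) (n : ℕ) :
    ∀ {Q : 𝒜} {p s : ℝ}, IsStrictlyPositive Q → Q ≤ P → 1 ≤ p → 1 ≤ s → s ≤ 2 ^ n →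
      cstarMean s (P ^ τ) (Q ^ p) ^ ((p - τ) * s + τ)⁻¹ ≤ P := by
  induction n with
  | zero =>
    intro Q p s hQ hQP hp hs hsn
    exact cstarMean_rpow_le_of_le_two hQ hQP hτ hp ⟨hs, hsn.trans (by norm_num)⟩
  | succ n ih =>
    intro Q p s hQ hQP hp hs hsn
    rcases le_total s 2 with h2 | h2
    · exact cstarMean_rpow_le_of_le_two hQ hQP hτ hp ⟨hs, h2⟩
    · have hP : IsStrictlyPositive P := hQ.of_le hQP
      have hp₁ : 1 ≤ (p - τ) * 2 + τ := by linarith [hτ.2]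
      have hM : IsStrictlyPositive (cstarMean 2 (P ^ τ) (Q ^ p)) :=
        isStrictlyPositive_cstarMean (hP.rpow P τ) (hQ.rpow Q p) 2
      have h := ih (p := (p - τ) * 2 + τ) (s := s / 2) (hM.rpow _ ((p - τ) * 2 + τ)⁻¹)
        (cstarMean_rpow_le_of_le_two hQ hQP hτ hp ⟨by norm_num, le_rfl⟩) hp₁
        (by linarith) (by rw [pow_succ] at hsn; linarith)
      rw [rpow_rpow_of_isStrictlyPositive hM, inv_mul_cancel₀ (by positivity),
        CFC.rpow_one _ hM.nonneg, cstarMean_cstarMean (hP.rpow P τ) (hQ.rpow Q p)] at h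
      convert h using 3 <;> ring

/-- The grand Furuta inequality with its outer exponent equal to its inner one. -/
lemma cstarMean_rpow_le {P Q : 𝒜} (hQ : IsStrictlyPositive Q) (hQP : Q ≤ P)
    {τ p s : ℝ} (hτ : τ ∈ Set.Icc (0 : ℝ) 1) (hp : 1 ≤ p) (hs : 1 ≤ s) :
    cstarMean s (P ^ τ) (Q ^ p) ^ ((p - τ) * s + τ)⁻¹ ≤ P := by
  obtain ⟨n, hn⟩ := pow_unbounded_of_one_lt s one_lt_two
  exact cstarMean_rpow_le_of_le_two_pow hτ n hQ hQP hp hs hn.le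

lemma rpow_mul_mul_rpow_le_one_iff {G Y : 𝒜} (hG : IsStrictlyPositive G)
    (hY : IsStrictlyPositive Y) (t : ℝ) :
    G ^ t * Y * G ^ t ≤ 1 ↔ G ^ (2 * t) ≤ Y ^ (-1 : ℝ) := by
  have hinv {Z : 𝒜} (hZ : IsStrictlyPositive Z) : (Z ^ (-1 : ℝ)) ^ (-1 : ℝ) = Z := by
    rw [rpow_rpow_of_isStrictlyPositive hZ]
    norm_num
    exact CFC.rpow_one Z hZ.nonneg
  have hY' : Y ≤ G ^ (-(2 * t)) ↔ G ^ (2 * t) ≤ Y ^ (-1 : ℝ) := by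
    have hGG : (G ^ (2 * t)) ^ (-1 : ℝ) = G ^ (-(2 * t)) := by
      rw [rpow_rpow_of_isStrictlyPositive hG, mul_neg_one]
    constructor
    · intro h
      rw [← hGG] at h
      simpa only [hinv (hG.rpow G (2 * t))] using CStarAlgebra.rpow_neg_one_le_rpow_neg_one h hY
    · intro h
      have := CStarAlgebra.rpow_neg_one_le_rpow_neg_one h (hG.rpow G (2 * t))
      rwa [hinv hY, hGG] at this
  rw [← hY']
  have h₁ := CFC.rpow_mul_rpow_neg t hG
  have h₂ := CFC.rpow_neg_mul_rpow t hG
  constructor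
  · intro h
    have := conjugate_le_conjugate_of_nonneg h (CFC.rpow_nonneg (a := G) (y := -t))
    rw [mul_one, rpow_mul_rpow hG, mul_assoc, mul_assoc, mul_assoc, h₁, mul_one, ← mul_assoc, h₂,
      one_mul] at this
    convert this using 2
    ring
  · intro h
    refine (conjugate_le_conjugate_of_nonneg h (CFC.rpow_nonneg (a := G) (y := t))).trans_eq ?_
    rw [rpow_mul_rpow hG, rpow_mul_rpow hG, ← CFC.rpow_zero G hG.nonneg]
    congr 1
    ring

theorem rpow_mul_mul_rpow_le_one_of_le {A B : 𝒜} (hA : IsStrictlyPositive A)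
    (hB : IsStrictlyPositive B) {k t L q : ℝ} (hk : k ∈ Set.Ioc (0 : ℝ) (1 / 2))
    (ht : t ∈ Set.Ioc (0 : ℝ) (1 / 2)) (hL : L = 1 + 2 * t - 4 * k * t)
    (h : cstarMean k (A ^ (-1 : ℝ)) B ^ t * A ^ L * cstarMean k (A ^ (-1 : ℝ)) B ^ t ≤ 1)
    (hq : 0 < q) (hq' : q ≤ 2 * k * t * L / (1 - 2 * k * t)) :
    cstarMean k ((A ^ q) ^ (-1 : ℝ)) (B ^ q) ^ t * (A ^ q) ^ L *
      cstarMean k ((A ^ q) ^ (-1 : ℝ)) (B ^ q) ^ t ≤ 1 := by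
  obtain ⟨hk₀, hk₁⟩ := hk
  obtain ⟨ht₀, ht₁⟩ := ht
  have hL₁ : 1 ≤ L := by nlinarith
  have hL₀ : 0 < L := by linarith
  have hkt : 0 < 1 - 2 * k * t := by nlinarith
  have hA' : IsStrictlyPositive (A ^ (-1 : ℝ)) := hA.rpow A _
  have hAq : IsStrictlyPositive (A ^ q) := hA.rpow A q
  have hBq : IsStrictlyPositive (B ^ q) := hB.rpow B q
  set G := cstarMean k (A ^ (-1 : ℝ)) B with hGdef
  have hG : IsStrictlyPositive G := isStrictlyPositive_cstarMean hA' hB k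
  rw [rpow_mul_mul_rpow_le_one_iff hG (hA.rpow A L), rpow_rpow_of_isStrictlyPositive hA,
    mul_neg_one] at h
  rw [rpow_mul_mul_rpow_le_one_iff (isStrictlyPositive_cstarMean (hAq.rpow _ _) hBq k)
    (hAq.rpow _ L)]
  simp only [rpow_rpow_of_isStrictlyPositive hA]
  have hB' : cstarMean k⁻¹ (A ^ (-1 : ℝ)) G = B := by
    rw [hGdef, cstarMean_cstarMean hA' hB, mul_inv_cancel₀ hk₀.ne', cstarMean_one hA' hB]
  have hF : B ^ (2 * k * t * L / (1 - 2 * k * t)) ≤ A ^ (-L) := by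
    -- With `P = A^(-L)` and `Q = G^(2t)`, these exponents make `P^τ = A⁻¹`, `Q^p = G`, and the mean
    -- equal to `B`.
    have := cstarMean_rpow_le (τ := L⁻¹) (p := (2 * t)⁻¹) (s := k⁻¹) (hG.rpow G (2 * t)) h
      ⟨by positivity, inv_le_one_of_one_le₀ hL₁⟩
      ((one_le_inv₀ (by positivity)).2 (by linarith)) ((one_le_inv₀ hk₀).2 (by linarith))
    rw [rpow_rpow_of_isStrictlyPositive hG, rpow_rpow_of_isStrictlyPositive hA,
      mul_inv_cancel₀ (by positivity), CFC.rpow_one G hG.nonneg, neg_mul,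
      mul_inv_cancel₀ hL₀.ne', hB'] at this
    convert this using 2
    rw [← inv_inj, inv_inv, inv_div]
    field_simp
    rw [hL]
    ring
  have hq₀ : 0 < 2 * k * t * L / (1 - 2 * k * t) := hq.trans_le hq'
  have hBA : B ^ q ≤ A ^ (-(q * (1 - 2 * k * t) / (2 * k * t))) := by
    have := CFC.rpow_le_rpow
      (p := q / (2 * k * t * L / (1 - 2 * k * t))) ⟨by positivity, (div_le_one hq₀).2 hq'⟩ hF
    rw [rpow_rpow_of_isStrictlyPositive hA, rpow_rpow_of_isStrictlyPositive hB,
      mul_div_cancel₀ _ hq₀.ne'] at this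
    convert this using 2
    field_simp
  have hmean := cstarMean_le_cstarMean (P := A ^ (q * -1)) hBA (s := k) ⟨hk₀.le, by linarith⟩
  rw [cstarMean_rpow_rpow hA] at hmean
  refine (CFC.rpow_le_rpow (p := 2 * t) ⟨by positivity, by linarith⟩ hmean).trans_eq ?_
  -- The exponent is `-q(2t(1 - k) + 1 - 2kt) = -qL`, which is where the form of `L` matters.
  rw [rpow_rpow_of_isStrictlyPositive hA]
  congr 1
  field_simp
  rw [hL]
  ring

end CStar

lemma spectralGeomMean_eq {H : Type*} [NormedAddCommGroup H] [InnerProductSpace ℂ H]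
    [CompleteSpace H] {k t : ℝ} {A B : H →L[ℂ] H} (hA : IsStrictlyPositive A) :
    spectralGeomMean k t A B =
      cstarMean k (A ^ (-1 : ℝ)) B ^ t * A ^ (1 + 2 * t - 4 * k * t) *
        cstarMean k (A ^ (-1 : ℝ)) B ^ t := by
  rw [spectralGeomMean, CFC.inverse_eq_rpow_neg_one hA]
  rfl

end SpectralGeomMean

theorem mainTheorem1 {H : Type*} [NormedAddCommGroup H] [InnerProductSpace ℂ H] [CompleteSpace H]
    (k t L : ℝ) (hk : k ∈ Set.Ioc (0 : ℝ) (1 / 2)) (ht : t ∈ Set.Ioc (0 : ℝ) (1 / 2))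
    (hL : L = 1 + 2 * t - 4 * k * t) :
    (∀ A B : H →L[ℂ] H, IsStrictlyPositive A → IsStrictlyPositive B →
      SpectralGeomMean.spectralGeomMean k t A B ≤ 1 →
        ∀ q : ℝ, 0 < q → q ≤ 2 * k * t * L / (1 - 2 * k * t) →
          SpectralGeomMean.spectralGeomMean k t (A ^ q) (B ^ q) ≤ 1) ∧
    (1 / (2 * k * t) - (1 - k) / (L * k))⁻¹ = 2 * k * t * L / (1 - 2 * k * t) ∧
    2 * k * t * L / (1 - 2 * k * t) ≤ 1 := by
  refine ⟨fun A B hA hB h q hq hq' => ?_, ?_, ?_⟩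
  · rw [SpectralGeomMean.spectralGeomMean_eq hA, ← hL] at h
    rw [SpectralGeomMean.spectralGeomMean_eq (hA.rpow A q), ← hL]
    exact SpectralGeomMean.rpow_mul_mul_rpow_le_one_of_le hA hB hk ht hL h hq hq'
  · obtain ⟨hk₀, hk₁⟩ := hk
    obtain ⟨ht₀, ht₁⟩ := ht
    have hL₀ : 0 < L := by nlinarith
    rw [← inv_inj, inv_inv, inv_div]
    field_simp
    rw [hL]
    ring
  · obtain ⟨hk₀, hk₁⟩ := hk
    obtain ⟨ht₀, ht₁⟩ := ht
    have hkt : 0 < 1 - 2 * k * t := by nlinarith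
    rw [div_le_one hkt, hL]
    -- The goal is `2kt(L + 1) ≤ 1`; the bound `k(3 - 2k)` is at most 1 because `(1 - k)(1 - 2k) ≥
    -- 0`.
    have h₁ : 2 * k * t * (2 + 2 * t * (1 - 2 * k)) ≤ k * (2 + (1 - 2 * k)) := by
      have h₂ : 2 * t * (1 - 2 * k) ≤ 1 - 2 * k :=
        mul_le_of_le_one_left (by linarith) (by linarith)
      have h₃ : 0 ≤ 2 * t * (1 - 2 * k) := mul_nonneg (by linarith) (by linarith)
      have h₄ : 2 * k * t ≤ k := by nlinarith
      exact mul_le_mul h₄ (by linarith) (by linarith) hk₀.le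
    nlinarith [mul_nonneg (show 0 ≤ 1 - k by linarith) (show 0 ≤ 1 - 2 * k by linarith)]
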